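/- Let $V=\mathbb C^3$ with basis $f_1,f_2,f_3$. For a commutative $\mathbb C$-algebra $R$ let $L_k\otimes R$ be the space of alternating $k$-linear maps $(R^3)^k\to R^3$, and for an increasing multi-index $I$ let $\varphi^I_j$ (written $\psi^I_j$ when $k=2$) be the map with $\varphi^I_j(f_J)=\delta^I_J f_j$. For $d\in L_2\otimes R$ put $$d^2(a,b,c)=d(d(a,b),c)-d(d(a,c),b)+d(d(b,c),a),\qquad [d,d]=2d^2;$$ $d$ is a codifferential (a Lie algebra structure) if $d^2=0$. For $g\in GL_3(R)$ put $g^*(d)=g^{-1}\circ d\circ g$; $d$ and $d'$ are equivalent over $R$ if $g^*(d)=d'$ for some $g$. For a homomorphism $f:R\to S$, $f_*$ denotes its application to the coefficients. A formal algebra is a local commutative $\mathbb C$-algebra $A$ with augmentation $\epsilon:A\to\mathbb C$, $\mathfrak m=\ker\epsilon$, such that $A=\varprojlim A/\mathfrak m^k$. A formal deformation of a codifferential $d\in L_2$ with base $A$ is a codifferential $d_A\in L_2\otimes A$ with $\epsilon_*(d_A)=d$. Two deformations $d_B,d_B'$ with the same base $B$ satisfy $d_B\sim d_B'$ if $g^*(d_B)=d_B'$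 for some $g\in GL_3(B)$ with $\epsilon_*(g)=1$. The deformation $d_A$ is versal if for every formal deformation $d_B$ of $d$, with any base $B$, there is a homomorphism $f:A\to B$ with $f_*(d_A)\sim d_B$; it is miniversal if moreover $f$ is unique whenever $\mathfrak m_B^2=0$. A formal deformation $d_t$ of $d$ with base $\mathbb C[[t]]$ is a jump deformation to $d'$ if $d_t$ is equivalent to $d'$ over $\mathbb C((t))$, while $d$ and $d'$ are not equivalent over $\mathbb C$. Let $d(\lambda:\mu)=\psi^{13}_1\lambda+\psi^{23}_1+\psi^{23}_2\mu$ and $d_3=\psi^{12}_3+\psi^{13}_2+\psi^{23}_1$, and let $$d^\infty=d^1=\psi^{13}_1(1+t^1)+\psi^{23}_1-\psi^{23}_2+\psi^{12}_3t^2$$ where $t^1,t^2$ are two parameters (the superscripts are indices, not powers). Then: 1. Over $\mathbb C[[t^1,t^2]]$ one has $[d^\infty,d^\infty]=-2\varphi^{123}_3\,t^1t^2$. 2. $d^\infty$, with base $A=\mathbb C[[t^1,t^2]]/(t^1t^2)$, is a miniversal deformation of $d(1:-1)$. 3. For $t^1,t^2\in\mathbb C$, $d^\infty$ is a codifferential if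 and only if $t^1=0$ or $t^2=0$. 4. Along $t^1=0$ (that is, after applying the homomorphism $A\to\mathbb C[[t]]$, $t^1\mapsto 0$, $t^2\mapsto t$) $d^\infty$ is a jump deformation from $d(1:-1)$ to $d_3$. For every complex $t^2\neq0$ the structure $d^\infty$ at $(0,t^2)$ satisfies $g^*(d^\infty)=d_3$, where $g$ is the invertible map with matrix $$G=\begin{bmatrix}0&-\frac12\frac{t^2-1}{t^2}&-\frac12\frac{1+t^2}{t^2}\\0&1&1\\1&0&0\end{bmatrix},$$ and $d_3$ is isomorphic, as a Lie algebra, to $\mathfrak{sl}_2(\mathbb C)$. 5. Along $t^2=0$ the deformation moves along the family $d(\lambda:\mu)$: applying the homomorphism $A\to\mathbb C[[t]]$, $t^1\mapsto t$, $t^2\mapsto0$, turns $d^\infty$ into $d(1+t:-1)$, and at each point $(t^1,0)\in\mathbb C^2$ one has $d^\infty=d(1+t^1:-1)$. For $s,t\in\mathbb C$ the structures $d(1+s:-1)$ and $d(1+t:-1)$ are equivalent if and only if $s=t$ or $(1+s)(1+t)=1$, i.e. if and only if $(1+s:-1)$ and $(1+t:-1)$ have the same class in $\mathbb P^1/\Sigma_2$;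 in particular, for $t\ne0$ the structure $d(1+t:-1)$ is not equivalent to $d(1:-1)$. -/

import Mathlib

open scoped PowerSeries LaurentSeries

universe u

noncomputable section

namespace LieDeform

/-- `L_k ⊗ R`, where `L_k = Hom(⋀^k V, V)` and `V = ℂ³`: alternating `k`-linear maps on `R³` with
values in `R³`.  Since `V` has finite dimension, for a complete local algebra `R` this is also the
completed tensor product. -/
abbrev Cochain (R : Type*) [CommRing R] (k : ℕ) : Type _ :=
  (Fin 3 → R) [⋀^Fin k]→ₗ[R] (Fin 3 → R)

/-- The basis element `φ^I_j` (also written `ψ^I_j`): it sends `f_I` to `f_j`, and `f_J` to `0`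
for the other increasing multi-indices `J`.  Indices start at `0`. -/
def phi (R : Type*) [CommRing R] {k : ℕ} (I : Fin k → Fin 3) (j : Fin 3) : Cochain R k :=
  (LinearMap.toSpanSingleton R (Fin 3 → R) (Pi.single j 1)).compAlternatingMap
    (Matrix.detRowAlternating.compLinearMap (LinearMap.funLeft R R I))

/-- The map `f_* : L_k ⊗ R → L_k ⊗ S` induced by `f : R → S`: apply `f` to the coefficients with
respect to the basis `φ^I_j`, with `I` running over the increasing multi-indices. -/
def push {R S : Type*} [CommRing R] [CommRing S] (f : R →+* S) {k : ℕ} (d : Cochain R k) :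
    Cochain S k :=
  ∑ I : {I : Fin k → Fin 3 // StrictMono I}, ∑ j : Fin 3,
    f (d (fun a => Pi.single (I.1 a) 1) j) • phi S I.1 j

/-- The self-bracket `[d, d] = 2 d²` of `d ∈ L_2`, as a function of three vectors. -/
def selfBracket {R : Type*} [CommRing R] (d : Cochain R 2) (v : Fin 3 → Fin 3 → R) : Fin 3 → R :=
  2 • (d ![d ![v 0, v 1], v 2] - d ![d ![v 0, v 2], v 1] + d ![d ![v 1, v 2], v 0])

/-- `d ∈ L_2` is a codifferential (a Lie algebra structure): `d² = 0`, the Jacobi relation. -/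
def IsCodifferential {R : Type*} [CommRing R] (d : Cochain R 2) : Prop :=
  ∀ a b c : Fin 3 → R, d ![d ![a, b], c] - d ![d ![a, c], b] + d ![d ![b, c], a] = 0

/-- `g^*(d) = g⁻¹ ∘ d ∘ g`. -/
def pullback {R : Type*} [CommRing R] {k : ℕ} (g : GL (Fin 3) R) (d : Cochain R k) : Cochain R k :=
  (Matrix.mulVecLin ((g⁻¹ : GL (Fin 3) R) : Matrix (Fin 3) (Fin 3) R)).compAlternatingMap
    (d.compLinearMap (Matrix.mulVecLin (g : Matrix (Fin 3) (Fin 3) R)))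

/-- Equivalence (isomorphism) of codifferentials over `R`. -/
def Equivalent {R : Type*} [CommRing R] (d d' : Cochain R 2) : Prop :=
  ∃ g : GL (Fin 3) R, pullback g d = d'

/-- A formal algebra with augmentation `ε`: a local `ℂ`-algebra that is the inverse limit of its
quotients by the powers of its maximal ideal `ker ε`. -/
structure IsFormalAlgebra (A : Type*) [CommRing A] [Algebra ℂ A] (ε : A →ₐ[ℂ] ℂ) : Prop where
  isLocalRing : IsLocalRing A
  isAdicComplete : IsAdicComplete (RingHom.ker ε) A

/-- `dA` is a formal deformation of `d` with base `A`. -/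
structure IsFormalDeformation (d : Cochain ℂ 2) (A : Type*) [CommRing A] [Algebra ℂ A]
    (ε : A →ₐ[ℂ] ℂ) (dA : Cochain A 2) : Prop where
  isFormalAlgebra : IsFormalAlgebra A ε
  isCodifferential : IsCodifferential dA
  push_eq : push (ε : A →+* ℂ) dA = d

/-- Equivalence of deformations with the same base, through an automorphism `g` with
`ε_*(g) = 1`. -/
def InfEquivalent {B : Type*} [CommRing B] [Algebra ℂ B] (ε : B →ₐ[ℂ] ℂ) (d d' : Cochain B 2) :
    Prop :=
  ∃ g : GL (Fin 3) B, Matrix.GeneralLinearGroup.map (ε : B →+* ℂ) g = 1 ∧ pullback g d = d'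

/-- A versal deformation: every formal deformation is equivalent to one induced from it.  Since
both algebras are local with residue field `ℂ`, an algebra homomorphism between them respects the
augmentations, and so is continuous. -/
def IsVersal (d : Cochain ℂ 2) (A : Type*) [CommRing A] [Algebra ℂ A]
    (ε : A →ₐ[ℂ] ℂ) (dA : Cochain A 2) : Prop :=
  IsFormalDeformation d A ε dA ∧
    ∀ (B : Type u) [CommRing B] [Algebra ℂ B] (εB : B →ₐ[ℂ] ℂ) (dB : Cochain B 2),
      IsFormalDeformation d B εB dB →
        ∃ f : A →ₐ[ℂ] B, InfEquivalent εB (push (f : A →+* B) dA) dB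

/-- A miniversal deformation: a versal one for which the homomorphism is unique whenever the base
`B` is infinitesimal, that is, whenever its maximal ideal has square zero. -/
def IsMiniversal (d : Cochain ℂ 2) (A : Type*) [CommRing A] [Algebra ℂ A]
    (ε : A →ₐ[ℂ] ℂ) (dA : Cochain A 2) : Prop :=
  IsVersal.{u} d A ε dA ∧
    ∀ (B : Type u) [CommRing B] [Algebra ℂ B] (εB : B →ₐ[ℂ] ℂ) (dB : Cochain B 2),
      IsFormalDeformation d B εB dB → RingHom.ker εB ^ 2 = ⊥ →
        ∀ f f' : A →ₐ[ℂ] B, InfEquivalent εB (push (f : A →+* B) dA) dB →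
          InfEquivalent εB (push (f' : A →+* B) dA) dB → f = f'

/-- The augmentation `ℂ[[t]] → ℂ`. -/
def powerSeriesAug : ℂ⟦X⟧ →ₐ[ℂ] ℂ :=
  { PowerSeries.constantCoeff (R := ℂ) with
    commutes' := fun r => by
      simp }

/-- The formal one-parameter deformation `dt` of `d`, with base `ℂ[[t]]`, is a jump deformation
to `d'`: outside `t = 0`, that is, over `ℂ((t))`, it is equivalent to the constant structure `d'`,
and `d'` is not equivalent to `d`. -/
def IsFormalJump (d d' : Cochain ℂ 2) (dt : Cochain ℂ⟦X⟧ 2) : Prop :=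
  IsFormalDeformation d ℂ⟦X⟧ powerSeriesAug dt ∧
    Equivalent (push (algebraMap ℂ⟦X⟧ ℂ⸨X⸩) dt) (push (algebraMap ℂ ℂ⸨X⸩) d') ∧
    ¬ Equivalent d d'

/-- `d(λ:μ) = ψ^{13}_1 λ + ψ^{23}_1 + ψ^{23}_2 μ`. -/
def dFam (R : Type*) [CommRing R] (l m : R) : Cochain R 2 :=
  l • phi R ![0, 2] 0 + phi R ![1, 2] 0 + m • phi R ![1, 2] 1

/-- `d_3 = ψ^{12}_3 + ψ^{13}_2 + ψ^{23}_1`. -/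
def dThree (R : Type*) [CommRing R] : Cochain R 2 :=
  phi R ![0, 1] 2 + phi R ![0, 2] 1 + phi R ![1, 2] 0

/-- `ψ^{13}_1 (1 + t₁) + ψ^{23}_1 - ψ^{23}_2 + ψ^{12}_3 t₂`. -/
def dInf (R : Type*) [CommRing R] (t₁ t₂ : R) : Cochain R 2 :=
  (1 + t₁) • phi R ![0, 2] 0 + phi R ![1, 2] 0 - phi R ![1, 2] 1 + t₂ • phi R ![0, 1] 2

/-- The ideal `(t₁ t₂)` of `ℂ[[t₁, t₂]]`. -/
abbrev relIdeal : Ideal (MvPowerSeries (Fin 2) ℂ) :=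
  Ideal.span {MvPowerSeries.X 0 * MvPowerSeries.X 1}

/-- The base `ℂ[[t₁, t₂]] / (t₁ t₂)`. -/
abbrev Base : Type := MvPowerSeries (Fin 2) ℂ ⧸ relIdeal

/-- The class of the variable `t_i` (with `i = 0, 1`) in the base. -/
def Base.t (i : Fin 2) : Base := Ideal.Quotient.mk relIdeal (MvPowerSeries.X i)

/-- The augmentation `ℂ[[t₁, t₂]] / (t₁ t₂) → ℂ`, which takes the constant term. -/
def Base.aug : Base →ₐ[ℂ] ℂ :=
  Ideal.Quotient.liftₐ relIdeal
    ({ MvPowerSeries.constantCoeff (σ := Fin 2) (R := ℂ) with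
        commutes' := fun r => by simp [MvPowerSeries.algebraMap_apply] } :
      MvPowerSeries (Fin 2) ℂ →ₐ[ℂ] ℂ)
    (by
      intro a ha
      obtain ⟨b, rfl⟩ := Ideal.mem_span_singleton.mp ha
      simp)

end LieDeform

end

/-!
A bracket on `R³` has the form `[x, y] = D (x × y)` for a unique matrix `D`, its structure matrix
(`ofMatrix`, `toMatrix`).  In these terms everything becomes algebra of bilinear forms:

* pulling back along `g` turns `D` into `D'` exactly when `det g • D = g D' gᵀ`
  (`pullback_ofMatrix_eq_iff`), a congruence up to the scalar `det g`;
* the Jacobi relation says that `D` kills the vector that represents its skew-symmetric part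
  (`IsCodifferential.mulVec_eq_zero`).

The structure matrix of `d(1 : -1)` is symmetric of rank two, with a hyperbolic upper left block.
Versality therefore needs no obstruction theory: a deformation over any formal algebra `B` is
brought to normal form directly.  Completing the square splits off the third basis vector from
the symmetric part, and the Jacobi relation then splits the skew part too
(`exists_infCongruent_block`).  Hensel's lemma in `B` gives an isotropic vector of the remaining
binary form (`exists_isotropic`), and a diagonal change of basis leaves exactly the matrix of
`dInf B t₁ t₂` (`exists_infCongruent_infMatrix`), whose Jacobi relation is `t₁ t₂ = 0`.  Since `B`
is complete, such a pair `(t₁, t₂)` comes from a homomorphism out of `ℂ[[t₁, t₂]] / (t₁ t₂)`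
(`IsFormalAlgebra.exists_algHom_base`).  When the maximal ideal of `B` has square zero, the skew
part and the last entry of the structure matrix recover `t₁` and `t₂`
(`InfCongruent.parameters_eq`), which gives uniqueness.

The base is a formal algebra because it is a Noetherian local quotient of a complete ring.  The
structures `d(1 : -1)` and `d_3` are told apart by the rank of the structure matrix, and the members
of the family `d(l : -1)` by comparing the determinants of the symmetric and skew parts of the
upper left block (`equivalent_dFam_iff`).
-/

noncomputable section

namespace LieDeform

/-! ### Structure matrices of brackets on `R³` -/

open Matrix

section Coordinates

variable {R : Type*} [CommRing R]

/-- The bracket on `R³` with `[x, y] = D (x × y)`. The columns of `D` are the brackets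
`[f₂, f₃]`, `[f₃, f₁]` and `[f₁, f₂]`. -/
def ofMatrix (D : Matrix (Fin 3) (Fin 3) R) : Cochain R 2 :=
  ∑ k, (D k 2 • phi R ![0, 1] k - D k 1 • phi R ![0, 2] k + D k 0 • phi R ![1, 2] k)

/-- The matrix of structure constants of a bracket on `R³`, inverse to `ofMatrix`. -/
def toMatrix (d : Cochain R 2) : Matrix (Fin 3) (Fin 3) R :=
  Matrix.of fun k => ![d ![Pi.single 1 1, Pi.single 2 1] k, d ![Pi.single 2 1, Pi.single 0 1] k,
    d ![Pi.single 0 1, Pi.single 1 1] k]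

theorem phi_apply {k : ℕ} (I : Fin k → Fin 3) (j : Fin 3) (v : Fin k → Fin 3 → R) :
    phi R I j v = Pi.single j (Matrix.of fun a b => v a (I b)).det := by
  change (Matrix.of fun a b => v a (I b)).det • Pi.single j (1 : R) = _
  rw [← Pi.single_smul, smul_eq_mul, mul_one]

theorem phi_two_apply (a b j : Fin 3) (x y : Fin 3 → R) :
    phi R ![a, b] j ![x, y] = Pi.single j (x a * y b - x b * y a) := by
  rw [phi_apply, Matrix.det_fin_two]
  simp

theorem ofMatrix_apply (D : Matrix (Fin 3) (Fin 3) R) (x y : Fin 3 → R) :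
    ofMatrix D ![x, y] = D *ᵥ (x ⨯₃ y) := by
  simp only [ofMatrix, Fin.sum_univ_three, AlternatingMap.add_apply, AlternatingMap.sub_apply,
    AlternatingMap.smul_apply, phi_two_apply, cross_apply]
  ext i
  fin_cases i <;> simp [Matrix.mulVec, dotProduct, Fin.sum_univ_three] <;> ring

theorem toMatrix_ofMatrix (D : Matrix (Fin 3) (Fin 3) R) : toMatrix (ofMatrix D) = D := by
  ext i j
  fin_cases j <;>
    simp [toMatrix, ofMatrix_apply, cross_apply, Matrix.mulVec, dotProduct, Fin.sum_univ_three]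

theorem cochain_two_ext {d d' : Cochain R 2} (h : ∀ x y, d ![x, y] = d' ![x, y]) : d = d' := by
  ext v i
  have hv : v = ![v 0, v 1] := by
    ext i; fin_cases i <;> rfl
  rw [hv, h]

theorem apply_swap (d : Cochain R 2) (x y : Fin 3 → R) : d ![x, y] = -d ![y, x] := by
  have := d.map_swap ![y, x] (i := 0) (j := 1) (by decide)
  rw [← this]
  congr 1
  ext i; fin_cases i <;> rfl

theorem apply_self (d : Cochain R 2) (x : Fin 3 → R) : d ![x, x] = 0 :=
  d.map_eq_zero_of_eq ![x, x] (i := 0) (j := 1) rfl (by decide)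

theorem ofMatrix_toMatrix (d : Cochain R 2) : ofMatrix (toMatrix d) = d := by
  refine Module.Basis.ext_alternating (Pi.basisFun R (Fin 3)) fun v _ => ?_
  have hv : (fun i => (Pi.basisFun R (Fin 3)) (v i)) =
      ![Pi.single (v 0) 1, Pi.single (v 1) 1] := by
    ext i; fin_cases i <;> simp
  rw [hv]
  generalize v 0 = a
  generalize v 1 = b
  have h10 := apply_swap d (Pi.single 1 1) (Pi.single 0 1)
  have h20 := apply_swap d (Pi.single 0 1) (Pi.single 2 1)
  have h21 := apply_swap d (Pi.single 2 1) (Pi.single 1 1)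
  rw [ofMatrix_apply]
  ext i
  fin_cases a <;> fin_cases b <;>
    simp [toMatrix, cross_apply, Matrix.mulVec, dotProduct, Fin.sum_univ_three, apply_self, h10,
      h20, h21]

theorem ofMatrix_injective : Function.Injective (ofMatrix (R := R)) :=
  Function.LeftInverse.injective toMatrix_ofMatrix

theorem push_ofMatrix {S : Type*} [CommRing S] (f : R →+* S) (D : Matrix (Fin 3) (Fin 3) R) :
    push f (ofMatrix D) = ofMatrix (D.map f) := by
  have huniv : (Finset.univ : Finset {I : Fin 2 → Fin 3 // StrictMono I}) =
      {⟨![0, 1], by decide⟩, ⟨![0, 2], by decide⟩, ⟨![1, 2], by decide⟩} := by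
    decide
  have hI (a b : Fin 3) : (fun i => Pi.single (![a, b] i) (1 : R)) =
      (![Pi.single a 1, Pi.single b 1] : Fin 2 → Fin 3 → R) := by
    ext i; fin_cases i <;> rfl
  rw [push, huniv, Finset.sum_insert (by decide), Finset.sum_insert (by decide),
    Finset.sum_singleton]
  simp only [hI, ofMatrix_apply]
  rw [ofMatrix, ← Finset.sum_add_distrib, ← Finset.sum_add_distrib]
  refine Finset.sum_congr rfl fun k _ => ?_
  simp [cross_apply, Matrix.mulVec, dotProduct, Fin.sum_univ_three]
  module

theorem cross_mulVec (g : Matrix (Fin 3) (Fin 3) R) (x y : Fin 3 → R) :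
    (g *ᵥ x) ⨯₃ (g *ᵥ y) = g.adjugateᵀ *ᵥ (x ⨯₃ y) := by
  rw [Matrix.adjugate_fin_three]
  ext i
  fin_cases i <;>
    simp [cross_apply, Matrix.mulVec, dotProduct, Fin.sum_univ_three] <;> ring

theorem pullback_apply (g : GL (Fin 3) R) (d : Cochain R 2) (x y : Fin 3 → R) :
    pullback g d ![x, y] = (g⁻¹).val *ᵥ d ![g.val *ᵥ x, g.val *ᵥ y] := by
  simp only [pullback, LinearMap.compAlternatingMap_apply, AlternatingMap.compLinearMap_apply,
    Matrix.mulVecLin_apply]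
  congr 2
  ext i; fin_cases i <;> rfl

/-- In terms of structure matrices, pulling back is a congruence up to the factor `det g`. -/
theorem pullback_ofMatrix_eq_iff (g : GL (Fin 3) R) (D D' : Matrix (Fin 3) (Fin 3) R) :
    pullback g (ofMatrix D) = ofMatrix D' ↔ g.val.det • D = g.val * D' * g.valᵀ := by
  have h1 : pullback g (ofMatrix D) = ofMatrix ((g⁻¹).val * D * g.val.adjugateᵀ) := by
    refine cochain_two_ext fun x y => ?_
    rw [pullback_apply, ofMatrix_apply, ofMatrix_apply, cross_mulVec, Matrix.mulVec_mulVec,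
      Matrix.mulVec_mulVec, Matrix.mul_assoc]
  have hadj : g.val.adjugateᵀ * g.valᵀ = g.val.det • (1 : Matrix (Fin 3) (Fin 3) R) := by
    rw [← Matrix.transpose_mul, Matrix.mul_adjugate, Matrix.transpose_smul, Matrix.transpose_one]
  have hinv : g.val * (g⁻¹).val = 1 := g.mul_inv
  have hinv' : (g⁻¹).val * g.val = 1 := g.inv_mul
  have hT : g.valᵀ * (g⁻¹).valᵀ = 1 := by
    rw [← Matrix.transpose_mul, hinv', Matrix.transpose_one]
  rw [h1, ofMatrix_injective.eq_iff]
  constructor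
  · rintro rfl
    simp only [Matrix.mul_assoc, hadj]
    rw [← Matrix.mul_assoc, hinv]
    simp
  · intro h
    have h2 : g.val * ((g⁻¹).val * D * g.val.adjugateᵀ) * g.valᵀ = g.val * D' * g.valᵀ := by
      rw [← h]
      simp only [Matrix.mul_assoc, hadj]
      rw [← Matrix.mul_assoc, hinv]
      simp
    have h3 (X : Matrix (Fin 3) (Fin 3) R) :
        (g⁻¹).val * (g.val * X * g.valᵀ) * (g⁻¹).valᵀ = X := by
      rw [Matrix.mul_assoc, Matrix.mul_assoc _ g.valᵀ, hT, Matrix.mul_one, ← Matrix.mul_assoc,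
        hinv', Matrix.one_mul]
    rw [← h3 (_ * _ * _), h2, h3]

theorem isCodifferential_pullback {d : Cochain R 2} (hd : IsCodifferential d) (g : GL (Fin 3) R) :
    IsCodifferential (pullback g d) := by
  intro a b c
  have hinv (x : Fin 3 → R) : g.val *ᵥ ((g⁻¹).val *ᵥ x) = x := by
    rw [Matrix.mulVec_mulVec, g.mul_inv, Matrix.one_mulVec]
  simp only [pullback_apply, hinv]
  rw [← Matrix.mulVec_sub, ← Matrix.mulVec_add, hd, Matrix.mulVec_zero]

/-- The Jacobi relation for three basis vectors says that the structure matrix kills the vector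
that represents its skew-symmetric part. -/
theorem IsCodifferential.mulVec_eq_zero {D : Matrix (Fin 3) (Fin 3) R}
    (h : IsCodifferential (ofMatrix D)) :
    D *ᵥ ![D 1 2 - D 2 1, D 2 0 - D 0 2, D 0 1 - D 1 0] = 0 := by
  have := h (Pi.single 0 1) (Pi.single 1 1) (Pi.single 2 1)
  simp only [ofMatrix_apply] at this
  rw [← Matrix.mulVec_sub, ← Matrix.mulVec_add] at this
  rw [← this]
  congr 1
  ext i
  fin_cases i <;> simp [cross_apply, Matrix.mulVec, dotProduct, Fin.sum_univ_three] <;> ring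

/-- The structure matrix of `dInf R t₁ t₂`. -/
def infMatrix (t₁ t₂ : R) : Matrix (Fin 3) (Fin 3) R :=
  !![1, -(1 + t₁), 0; -1, 0, 0; 0, 0, t₂]

theorem dInf_eq (t₁ t₂ : R) : dInf R t₁ t₂ = ofMatrix (infMatrix t₁ t₂) := by
  rw [ofMatrix, dInf, infMatrix]
  simp [Fin.sum_univ_three]
  module

theorem dFam_eq (l : R) : dFam R l (-1) = ofMatrix (infMatrix (l - 1) 0) := by
  rw [← dInf_eq, dInf, dFam]
  simp
  module

theorem dThree_eq : dThree R = ofMatrix !![1, 0, 0; 0, -1, 0; 0, 0, 1] := by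
  rw [ofMatrix, dThree]
  simp [Fin.sum_univ_three]
  module

theorem infMatrix_map {S : Type*} [CommRing S] (f : R →+* S) (t₁ t₂ : R) :
    (infMatrix t₁ t₂).map f = infMatrix (f t₁) (f t₂) := by
  ext i j
  fin_cases i <;> fin_cases j <;> simp [infMatrix]

theorem push_dInf {S : Type*} [CommRing S] (f : R →+* S) (t₁ t₂ : R) :
    push f (dInf R t₁ t₂) = dInf S (f t₁) (f t₂) := by
  rw [dInf_eq, push_ofMatrix, infMatrix_map, dInf_eq]

theorem push_dThree {S : Type*} [CommRing S] (f : R →+* S) :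
    push f (dThree R) = dThree S := by
  rw [dThree_eq, push_ofMatrix, dThree_eq]
  congr 1
  ext i j
  fin_cases i <;> fin_cases j <;> simp

theorem dInf_jacobiator (t₁ t₂ : R) (a b c : Fin 3 → R) :
    dInf R t₁ t₂ ![dInf R t₁ t₂ ![a, b], c] - dInf R t₁ t₂ ![dInf R t₁ t₂ ![a, c], b] +
      dInf R t₁ t₂ ![dInf R t₁ t₂ ![b, c], a] =
    (-(t₁ * t₂)) • phi R ![0, 1, 2] 2 ![a, b, c] := by
  simp only [dInf_eq, ofMatrix_apply]
  rw [phi_apply, Matrix.det_fin_three]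
  ext i
  fin_cases i <;>
    simp [infMatrix, cross_apply] <;> ring

theorem isCodifferential_dInf_iff (t₁ t₂ : R) :
    IsCodifferential (dInf R t₁ t₂) ↔ t₁ * t₂ = 0 := by
  constructor
  · intro h
    rw [dInf_eq] at h
    have := congr_fun h.mulVec_eq_zero 2
    simpa [infMatrix, Matrix.mulVec, dotProduct, Fin.sum_univ_three, mul_comm] using this
  · intro h a b c
    rw [dInf_jacobiator, h, neg_zero, zero_smul]

end Coordinates

/-! ### Formal algebras and the base `ℂ[[t₁, t₂]] / (t₁ t₂)` -/

section FormalAlgebras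

theorem isPrecomplete_map_of_surjective {R S : Type*} [CommRing R] [CommRing S] {f : R →+* S}
    (hf : Function.Surjective f) (I : Ideal R) [IsPrecomplete I R] :
    IsPrecomplete (I.map f) S := by
  have hmem {n : ℕ} {y : S} : y ∈ I.map f ^ n ↔ ∃ x ∈ I ^ n, f x = y := by
    rw [← Ideal.map_pow, Ideal.mem_map_iff_of_surjective f hf]
  refine ⟨fun u hu => ?_⟩
  simp only [smul_eq_mul, Ideal.mul_top, SModEq.sub_mem] at hu ⊢
  -- Lift the sequence by lifting its first term and its successive differences.
  have hd (n : ℕ) : ∃ x ∈ I ^ n, f x = u (n + 1) - u n := by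
    rw [← hmem, ← neg_mem_iff, neg_sub]
    exact hu n.le_succ
  choose d hdI hdf using hd
  obtain ⟨x₀, hx₀⟩ := hf (u 0)
  let v : ℕ → R := fun n => x₀ + ∑ k ∈ Finset.range n, d k
  have hv (n : ℕ) : f (v n) = u n := by
    simp only [v, map_add, map_sum, hdf, hx₀, Finset.sum_range_sub, add_sub_cancel]
  obtain ⟨L, hL⟩ := IsPrecomplete.prec (I := I) inferInstance (f := v) (by
    intro m n hmn
    rw [smul_eq_mul, Ideal.mul_top, SModEq.sub_mem, ← neg_mem_iff, neg_sub]
    simp only [v, add_sub_add_left_eq_sub, ← Finset.sum_Ico_eq_sub d hmn]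
    exact Ideal.sum_mem _ fun k hk =>
      Ideal.pow_le_pow_right (Finset.mem_Ico.mp hk).1 (hdI k))
  refine ⟨f L, fun n => hmem.mpr ⟨v n - L, ?_, by rw [map_sub, hv]⟩⟩
  simpa only [smul_eq_mul, Ideal.mul_top, SModEq.sub_mem] using hL n

theorem ker_constantCoeff_eq_span :
    RingHom.ker (MvPowerSeries.constantCoeff (σ := Fin 2) (R := ℂ)) =
      Ideal.span (Set.range MvPowerSeries.X) := by
  refine le_antisymm (fun p hp => ?_) (Ideal.span_le.mpr ?_)
  · rw [RingHom.mem_ker] at hp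
    -- The part of `p` without `X 0` is divisible by `X 1`.
    let q : MvPowerSeries (Fin 2) ℂ := fun m => if m 0 = 0 then MvPowerSeries.coeff m p else 0
    have hq (m) : MvPowerSeries.coeff m q = if m 0 = 0 then MvPowerSeries.coeff m p else 0 := rfl
    have h1 : MvPowerSeries.X 1 ∣ q := by
      rw [MvPowerSeries.X_dvd_iff]
      intro m hm
      rw [hq]
      split_ifs with h
      · have : m = 0 := by
          ext i; fin_cases i <;> assumption
        rw [this]
        simpa using hp
      · rfl
    have h0 : MvPowerSeries.X 0 ∣ p - q := by
      rw [MvPowerSeries.X_dvd_iff]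
      intro m hm
      rw [map_sub, hq, if_pos hm, sub_self]
    rw [← sub_add_cancel p q]
    exact add_mem (Ideal.mem_of_dvd _ h0 (Ideal.subset_span ⟨0, rfl⟩))
      (Ideal.mem_of_dvd _ h1 (Ideal.subset_span ⟨1, rfl⟩))
  · rintro _ ⟨i, rfl⟩
    simp [RingHom.mem_ker]

theorem Base.aug_mk (p : MvPowerSeries (Fin 2) ℂ) :
    Base.aug (Ideal.Quotient.mk relIdeal p) = MvPowerSeries.constantCoeff p := rfl

theorem Base.aug_t (i : Fin 2) : Base.aug (Base.t i) = 0 := by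
  rw [Base.t, Base.aug_mk, MvPowerSeries.constantCoeff_X]

theorem Base.t_mul_t : Base.t 0 * Base.t 1 = 0 := by
  rw [Base.t, Base.t, ← map_mul, Ideal.Quotient.eq_zero_iff_mem]
  exact Ideal.subset_span rfl

theorem Base.ker_aug : RingHom.ker Base.aug =
    (Ideal.span (Set.range MvPowerSeries.X)).map (Ideal.Quotient.mk relIdeal) := by
  rw [← ker_constantCoeff_eq_span]
  ext x
  rw [Ideal.mem_map_iff_of_surjective _ Ideal.Quotient.mk_surjective]
  constructor
  · obtain ⟨p, rfl⟩ := Ideal.Quotient.mk_surjective x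
    exact fun hp => ⟨p, hp, rfl⟩
  · rintro ⟨p, hp, rfl⟩
    exact hp

instance Base.isLocalRing : IsLocalRing Base :=
  have : Nontrivial Base := Base.aug.toRingHom.domain_nontrivial
  .of_surjective' (Ideal.Quotient.mk relIdeal) Ideal.Quotient.mk_surjective

theorem Base.isFormalAlgebra : IsFormalAlgebra Base Base.aug where
  isLocalRing := inferInstance
  isAdicComplete :=
    { toIsHausdorff := .of_isLocalRing _ _ (RingHom.ker_ne_top _)
      toIsPrecomplete := by
        rw [Base.ker_aug]
        exact isPrecomplete_map_of_surjective Ideal.Quotient.mk_surjective _ }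

theorem powerSeries_isFormalAlgebra : IsFormalAlgebra ℂ⟦X⟧ powerSeriesAug where
  isLocalRing := inferInstance
  isAdicComplete := by
    have : RingHom.ker powerSeriesAug = Ideal.span {PowerSeries.X} := by
      rw [← PowerSeries.maximalIdeal_eq_span_X, ← PowerSeries.ker_coeff_eq_max_ideal]
      rfl
    rw [this]
    infer_instance

namespace IsFormalAlgebra

variable {B : Type*} [CommRing B] [Algebra ℂ B] {ε : B →ₐ[ℂ] ℂ}

theorem isUnit_iff (h : IsFormalAlgebra B ε) {x : B} : IsUnit x ↔ ε x ≠ 0 := by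
  have := h.isLocalRing
  refine ⟨fun hx => (hx.map ε).ne_zero, fun hx => ?_⟩
  have hmax : (RingHom.ker ε).IsMaximal :=
    RingHom.ker_isMaximal_of_surjective ε fun c => ⟨algebraMap ℂ B c, ε.commutes c⟩
  rw [← not_not (a := IsUnit x), ← mem_nonunits_iff, ← IsLocalRing.mem_maximalIdeal,
    ← IsLocalRing.eq_maximalIdeal hmax]
  exact hx

/-- A homomorphism of algebras out of a formal algebra respects the augmentations, because the
augmentation is the only homomorphism to `ℂ`. -/
theorem algHom_eq (h : IsFormalAlgebra B ε) (φ : B →ₐ[ℂ] ℂ) : φ = ε := by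
  ext x
  by_contra hne
  have hu : IsUnit (x - algebraMap ℂ B (φ x)) := by
    rw [h.isUnit_iff, map_sub, ε.commutes]
    exact sub_ne_zero.mpr (Ne.symm hne)
  refine (hu.map φ).ne_zero ?_
  rw [map_sub, φ.commutes]
  exact sub_self _

theorem exists_algHom_mvPowerSeries (h : IsFormalAlgebra B ε) (b : Fin 2 → B)
    (hb : ∀ i, ε (b i) = 0) :
    ∃ f : MvPowerSeries (Fin 2) ℂ →ₐ[ℂ] B, ∀ i, f (MvPowerSeries.X i) = b i := by
  -- Evaluation takes place in the adic topology of `B`; any `ℂ`-algebra structure is continuous for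
  -- the discrete topology on `ℂ`.
  let : UniformSpace ℂ := ⊥
  have : DiscreteTopology ℂ := ⟨rfl⟩
  have : DiscreteUniformity ℂ := ⟨rfl⟩
  let : WithIdeal B := ⟨RingHom.ker ε⟩
  obtain ⟨_, _⟩ := (IsAdic.isAdicComplete_iff (R := B) (I := RingHom.ker ε) rfl).mp
    h.isAdicComplete
  have hE : MvPowerSeries.HasEval b :=
    { hpow := fun i => WithIdeal.isTopologicallyNilpotent_of_mem (hb i)
      tendsto_zero := by simp [Filter.cofinite_eq_bot] }
  have hc : Continuous (algebraMap ℂ B) := continuous_of_discreteTopology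
  refine ⟨{ MvPowerSeries.eval₂Hom hc hE with commutes' := fun r => ?_ }, fun i => ?_⟩
  · change MvPowerSeries.eval₂Hom hc hE _ = _
    rw [MvPowerSeries.coe_eval₂Hom, ← MvPowerSeries.c_eq_algebraMap, MvPowerSeries.eval₂_C]
  · change MvPowerSeries.eval₂Hom hc hE _ = _
    rw [MvPowerSeries.coe_eval₂Hom, MvPowerSeries.eval₂_X]

/-- Two elements of the maximal ideal with product zero are the images of the variables under a
homomorphism from the base `ℂ[[t₁, t₂]] / (t₁ t₂)`. -/
theorem exists_algHom_base (h : IsFormalAlgebra B ε) {b₁ b₂ : B} (h₁ : ε b₁ = 0) (h₂ : ε b₂ = 0)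
    (h₁₂ : b₁ * b₂ = 0) :
    ∃ f : Base →ₐ[ℂ] B, f (Base.t 0) = b₁ ∧ f (Base.t 1) = b₂ := by
  obtain ⟨f, hf⟩ := h.exists_algHom_mvPowerSeries ![b₁, b₂] (by simp [Fin.forall_fin_two, h₁, h₂])
  have hrel : ∀ a ∈ relIdeal, f a = 0 := by
    intro a ha
    obtain ⟨c, rfl⟩ := Ideal.mem_span_singleton.mp ha
    simp [hf, h₁₂]
  exact ⟨Ideal.Quotient.liftₐ relIdeal f hrel, hf 0, hf 1⟩

/-- Over an infinitesimal base, a homomorphism out of `ℂ[[t₁, t₂]] / (t₁ t₂)` is determined by the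
images of the two variables. -/
theorem base_algHom_ext (hm : RingHom.ker ε ^ 2 = ⊥) {f f' : Base →ₐ[ℂ] B}
    (h : ∀ i, f (Base.t i) = f' (Base.t i)) : f = f' := by
  have haug (f : Base →ₐ[ℂ] B) (x : Base) : ε (f x) = Base.aug x :=
    DFunLike.congr_fun (Base.isFormalAlgebra.algHom_eq (ε.comp f)) x
  have hmul {x y : B} (hx : ε x = 0) (hy : ε y = 0) : x * y = 0 := by
    rw [← Ideal.mem_bot, ← hm, pow_two]
    exact Ideal.mul_mem_mul hx hy
  ext x
  have hx : x - algebraMap ℂ Base (Base.aug x) ∈ RingHom.ker Base.aug := by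
    rw [RingHom.mem_ker, map_sub, Base.aug.commutes]
    exact sub_self _
  rw [Base.ker_aug, Ideal.map_span] at hx
  suffices H : ∀ y ∈ Ideal.span ((Ideal.Quotient.mk relIdeal) '' Set.range MvPowerSeries.X),
      f y = f' y by
    have := H _ hx
    rw [map_sub, map_sub, f.commutes, f'.commutes] at this
    exact sub_left_injective this
  intro y hy
  induction hy using Submodule.span_induction with
  | mem y hy =>
    obtain ⟨_, ⟨i, rfl⟩, rfl⟩ := hy
    exact h i
  | zero => rw [map_zero, map_zero]
  | add y z _ _ hy hz => rw [map_add, map_add, hy, hz]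
  | smul a y hyI hy =>
    have hy0 : Base.aug y = 0 := by
      rw [← RingHom.mem_ker, Base.ker_aug, Ideal.map_span]
      exact hyI
    have hdiff : (f a - f' a) * f y = 0 :=
      hmul (by rw [map_sub, haug, haug, sub_self]) (by rw [haug, hy0])
    rw [smul_eq_mul, map_mul, map_mul, ← hy, ← sub_eq_zero, ← sub_mul, hdiff]

end IsFormalAlgebra

end FormalAlgebras

/-! ### Normal form and versality -/

section Versality

variable {B : Type*} [CommRing B] [Algebra ℂ B] {ε : B →ₐ[ℂ] ℂ}

/-- The relation between structure matrices that corresponds to `InfEquivalent`. -/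
def InfCongruent (ε : B →ₐ[ℂ] ℂ) (D D' : Matrix (Fin 3) (Fin 3) B) : Prop :=
  ∃ g : GL (Fin 3) B, Matrix.GeneralLinearGroup.map (ε : B →+* ℂ) g = 1 ∧
    g.val.det • D = g.val * D' * g.valᵀ

theorem infEquivalent_ofMatrix_iff {D D' : Matrix (Fin 3) (Fin 3) B} :
    InfEquivalent ε (ofMatrix D) (ofMatrix D') ↔ InfCongruent ε D D' :=
  exists_congr fun g => and_congr_right fun _ => pullback_ofMatrix_eq_iff g D D'

namespace InfCongruent

variable {D D' D'' : Matrix (Fin 3) (Fin 3) B}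

theorem trans (h : InfCongruent ε D D') (h' : InfCongruent ε D' D'') : InfCongruent ε D D'' := by
  obtain ⟨g, hg, h⟩ := h
  obtain ⟨g', hg', h'⟩ := h'
  refine ⟨g * g', by rw [map_mul, hg, hg', one_mul], ?_⟩
  have h1 : (g * g').val = g.val * g'.val := rfl
  rw [h1, Matrix.det_mul, mul_comm, mul_smul, h, ← Matrix.smul_mul, ← Matrix.mul_smul, h',
    Matrix.transpose_mul]
  simp only [Matrix.mul_assoc]

theorem symm (h : InfCongruent ε D D') : InfCongruent ε D' D := by
  obtain ⟨g, hg, h⟩ := h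
  refine ⟨g⁻¹, by rw [map_inv, hg, inv_one], ?_⟩
  rw [← pullback_ofMatrix_eq_iff] at h ⊢
  rw [← h]
  refine cochain_two_ext fun x y => ?_
  have hinv (x : Fin 3 → B) : g.val *ᵥ ((g⁻¹).val *ᵥ x) = x := by
    rw [Matrix.mulVec_mulVec, g.mul_inv, Matrix.one_mulVec]
  rw [pullback_apply, pullback_apply, inv_inv, hinv, hinv, hinv]

theorem isCodifferential (h : InfCongruent ε D D') (hD : IsCodifferential (ofMatrix D)) :
    IsCodifferential (ofMatrix D') := by
  obtain ⟨g, -, h⟩ := h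
  rw [← (pullback_ofMatrix_eq_iff g D D').mpr h]
  exact isCodifferential_pullback hD g

theorem of_matrix (hA : IsFormalAlgebra B ε) (g : Matrix (Fin 3) (Fin 3) B) (hg : g.map ε = 1)
    (h : g.det • D = g * D' * gᵀ) : InfCongruent ε D D' := by
  have hu : IsUnit g.det := by
    rw [hA.isUnit_iff]
    have := AlgHom.map_det ε g
    rw [AlgHom.mapMatrix_apply, hg, Matrix.det_one] at this
    rw [this]
    exact one_ne_zero
  refine ⟨Matrix.GeneralLinearGroup.mk'' g hu, ?_, h⟩
  ext i j
  exact congr_fun₂ hg i j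

end InfCongruent

theorem mul_mul_transpose_apply {R : Type*} [CommRing R] (g M : Matrix (Fin 3) (Fin 3) R)
    (i j : Fin 3) :
    (g * M * gᵀ) i j = (g i 0 * M 0 0 + g i 1 * M 1 0 + g i 2 * M 2 0) * g j 0 +
      (g i 0 * M 0 1 + g i 1 * M 1 1 + g i 2 * M 2 1) * g j 1 +
      (g i 0 * M 0 2 + g i 1 * M 1 2 + g i 2 * M 2 2) * g j 2 := by
  simp [Matrix.mul_apply, Fin.sum_univ_three]

/-- Completing the square: a shear removes the mixed part of the symmetrised structure matrix,
whose upper left block is invertible.  The Jacobi relation then removes the mixed part of the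
skew-symmetrisation. -/
theorem exists_infCongruent_block (hA : IsFormalAlgebra B ε) {M : Matrix (Fin 3) (Fin 3) B}
    (hM : IsCodifferential (ofMatrix M)) (hε : M.map ε = infMatrix 0 0) :
    ∃ N, InfCongruent ε N M ∧ N.map ε = infMatrix 0 0 ∧
      N 0 2 = 0 ∧ N 1 2 = 0 ∧ N 2 0 = 0 ∧ N 2 1 = 0 := by
  have e (i j) : ε (M i j) = infMatrix (0 : ℂ) 0 i j := congr_fun₂ hε i j
  obtain ⟨u, hu⟩ : IsUnit (4 * M 0 0 * M 1 1 - (M 0 1 + M 1 0) ^ 2) := by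
    rw [hA.isUnit_iff]
    simp [e, infMatrix]
  have huinv : (4 * M 0 0 * M 1 1 - (M 0 1 + M 1 0) ^ 2) * ↑u⁻¹ = 1 := by
    rw [← hu, u.mul_inv]
  -- Cramer's rule for the shear `(y₁, y₂)`.
  obtain ⟨y₁, hy₁⟩ : ∃ y, y = (-(2 * M 1 1 * (M 0 2 + M 2 0) -
    (M 0 1 + M 1 0) * (M 1 2 + M 2 1))) * ↑u⁻¹ := ⟨_, rfl⟩
  obtain ⟨y₂, hy₂⟩ : ∃ y, y = (-(2 * M 0 0 * (M 1 2 + M 2 1) -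
    (M 0 1 + M 1 0) * (M 0 2 + M 2 0))) * ↑u⁻¹ := ⟨_, rfl⟩
  have h₁ : M 0 2 + M 2 0 + 2 * M 0 0 * y₁ + (M 0 1 + M 1 0) * y₂ = 0 := by
    rw [hy₁, hy₂]
    linear_combination (-(M 0 2 + M 2 0)) * huinv
  have h₂ : M 1 2 + M 2 1 + (M 0 1 + M 1 0) * y₁ + 2 * M 1 1 * y₂ = 0 := by
    rw [hy₁, hy₂]
    linear_combination (-(M 1 2 + M 2 1)) * huinv
  have hy₁ε : ε y₁ = 0 := by
    simp [hy₁, e, infMatrix]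
  have hy₂ε : ε y₂ = 0 := by
    simp [hy₂, e, infMatrix]
  let g : Matrix (Fin 3) (Fin 3) B := !![1, 0, 0; 0, 1, 0; y₁, y₂, 1]
  have hgε : g.map ε = 1 := by
    ext i j
    fin_cases i <;> fin_cases j <;> simp [g, hy₁ε, hy₂ε]
  have hgdet : g.det = 1 := by
    simp [g, Matrix.det_fin_three]
  have hNM : InfCongruent ε (g * M * gᵀ) M := .of_matrix hA g hgε (by rw [hgdet, one_smul])
  have hNε : (g * M * gᵀ).map ε = infMatrix 0 0 := by
    have : (g * M * gᵀ).map (ε : B →+* ℂ) = g.map ε * M.map ε * (g.map ε)ᵀ := by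
      rw [Matrix.map_mul, Matrix.map_mul, Matrix.transpose_map]
      rfl
    exact this.trans (by rw [hgε, hε, Matrix.one_mul, Matrix.transpose_one, Matrix.mul_one])
  have hJ := (hNM.symm.isCodifferential hM).mulVec_eq_zero
  have hs₁ : (g * M * gᵀ) 0 2 + (g * M * gᵀ) 2 0 = 0 := by
    rw [← h₁, mul_mul_transpose_apply, mul_mul_transpose_apply]
    simp [g]
    ring
  have hs₂ : (g * M * gᵀ) 1 2 + (g * M * gᵀ) 2 1 = 0 := by
    rw [← h₂, mul_mul_transpose_apply, mul_mul_transpose_apply]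
    simp [g]
    ring
  generalize g * M * gᵀ = N at *
  have e' (i j) : ε (N i j) = infMatrix (0 : ℂ) 0 i j := congr_fun₂ hNε i j
  have hv : IsUnit (4 * N 0 0 * N 1 1 - (N 0 1 + N 1 0) ^ 2) := by
    rw [hA.isUnit_iff]
    simp [e', infMatrix]
  have hJ₀ := congr_fun hJ 0
  have hJ₁ := congr_fun hJ 1
  simp only [Matrix.mulVec, dotProduct, Fin.sum_univ_three, Matrix.cons_val, Pi.zero_apply]
    at hJ₀ hJ₁
  have h20 : N 2 0 = -N 0 2 := by linear_combination hs₁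
  have h21 : N 2 1 = -N 1 2 := by linear_combination hs₂
  rw [h20, h21] at hJ₀ hJ₁
  have h02 : N 0 2 = 0 := by
    rw [← hv.mul_right_eq_zero]
    linear_combination (N 0 1 + N 1 0) * hJ₀ - 2 * N 0 0 * hJ₁
  have h12 : N 1 2 = 0 := by
    rw [← hv.mul_right_eq_zero]
    linear_combination 2 * N 1 1 * hJ₀ - (N 0 1 + N 1 0) * hJ₁
  exact ⟨N, hNM, hNε, h02, h12, by rw [h20, h02, neg_zero],
    by rw [h21, h12, neg_zero]⟩

/-- Hensel's lemma provides an isotropic vector of the upper left block, which is hyperbolic modulo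
the maximal ideal. -/
theorem exists_isotropic (hA : IsFormalAlgebra B ε) {p q r : B} (hp : ε p = 1) (hq : ε q = -2)
    (hr : ε r = 0) : ∃ x, ε x = 0 ∧ r + x * q + x ^ 2 * p = 0 := by
  have := hA.isAdicComplete
  obtain ⟨u, hu⟩ : IsUnit p := hA.isUnit_iff.mpr (by rw [hp]; exact one_ne_zero)
  have hui : ε ↑u⁻¹ = 1 := by
    have := congrArg ε u.inv_mul
    rwa [map_mul, hu, hp, mul_one, map_one] at this
  let f : Polynomial B :=
    Polynomial.X ^ 2 + Polynomial.C (↑u⁻¹ * q) * Polynomial.X + Polynomial.C (↑u⁻¹ * r)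
  have hf : f.Monic := by
    simp only [f]
    monicity!
  obtain ⟨x, hx, hx0⟩ := HenselianRing.is_henselian (I := RingHom.ker ε) f hf 0
    (by simp [f, RingHom.mem_ker, hr]) (by
      refine IsUnit.map _ (hA.isUnit_iff.mpr ?_)
      simp [f, hui, hq])
  refine ⟨x, by simpa [RingHom.mem_ker] using hx0, ?_⟩
  have hx' : x ^ 2 + ↑u⁻¹ * q * x + ↑u⁻¹ * r = 0 := by
    simpa [f, Polynomial.IsRoot] using hx
  have hpu : p * ↑u⁻¹ = 1 := by rw [← hu, u.mul_inv]
  linear_combination p * hx' - (q * x + r) * hpu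

/-- The normal form of a deformation: every codifferential that reduces to `d(1 : -1)` is
infinitesimally equivalent to some `dInf B t₁ t₂`. -/
theorem exists_infCongruent_infMatrix (hA : IsFormalAlgebra B ε) {M : Matrix (Fin 3) (Fin 3) B}
    (hM : IsCodifferential (ofMatrix M)) (hε : M.map ε = infMatrix 0 0) :
    ∃ t₁ t₂ : B, ε t₁ = 0 ∧ ε t₂ = 0 ∧ InfCongruent ε (infMatrix t₁ t₂) M := by
  obtain ⟨N, hNM, hNε, h02, h12, h20, h21⟩ := exists_infCongruent_block hA hM hε
  have e (i j) : ε (N i j) = infMatrix (0 : ℂ) 0 i j := congr_fun₂ hNε i j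
  obtain ⟨x, hxε, hx⟩ := exists_isotropic hA (p := N 0 0) (q := N 0 1 + N 1 0) (r := N 1 1)
    (by simp [e, infMatrix]) (by simp [e, infMatrix]; norm_num) (by simp [e, infMatrix])
  obtain ⟨u, hu⟩ : IsUnit (N 0 0) := hA.isUnit_iff.mpr (by simp [e, infMatrix])
  obtain ⟨v, hv⟩ : IsUnit (N 1 0 + x * N 0 0) := hA.isUnit_iff.mpr (by simp [e, infMatrix, hxε])
  have hui : N 0 0 * ↑u⁻¹ = 1 := by rw [← hu, u.mul_inv]
  have hvi : (N 1 0 + x * N 0 0) * ↑v⁻¹ = 1 := by rw [← hv, v.mul_inv]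
  have huε : ε ↑u⁻¹ = 1 := by
    simpa [e, infMatrix] using congrArg ε hui
  have hvε : ε ↑v⁻¹ = -1 := by
    have h1 : ε (N 1 0 + x * N 0 0) = -1 := by simp [e, infMatrix, hxε]
    have h2 := congrArg ε hvi
    rw [map_mul, h1, map_one] at h2
    linear_combination -h2
  -- `c` is the scaling of the third basis vector, `c / p` that of the first one.
  obtain ⟨c, hc⟩ : ∃ c, c = -(N 1 0 + x * N 0 0) := ⟨_, rfl⟩
  have hcv : c * ↑v⁻¹ = -1 := by rw [hc, neg_mul, hvi]
  let g : Matrix (Fin 3) (Fin 3) B := !![c * ↑u⁻¹, 0, 0; x, 1, 0; 0, 0, c]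
  refine ⟨(N 0 1 + x * N 0 0) * ↑v⁻¹ - 1, N 0 0 * N 2 2, ?_, ?_,
    InfCongruent.trans (.of_matrix hA g ?_ ?_) hNM⟩
  · simp [e, infMatrix, hxε, hvε]
  · simp [e, infMatrix]
  · ext i j
    fin_cases i <;> fin_cases j <;> simp [g, hc, e, infMatrix, hxε, huε]
  · have hdet : g.det = c * ↑u⁻¹ * c := by
      simp [g, Matrix.det_fin_three]
    rw [hdet]
    ext i j
    rw [mul_mul_transpose_apply, h02, h12, h20, h21]
    fin_cases i <;> fin_cases j <;> simp [g, infMatrix]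
    · linear_combination (-(c ^ 2 * ↑u⁻¹)) * hui
    · linear_combination (-(c * ↑u⁻¹ * (N 0 1 + x * N 0 0))) * hcv
    · linear_combination (-(c * ↑u⁻¹)) * hc
    · linear_combination -hx
    · linear_combination c ^ 2 * N 2 2 * hui

/-- Over an infinitesimal base the parameters of the normal form are invariants: to first order,
`t₁` is read off from the skew part of the structure matrix, and `t₂` from its last entry. -/
theorem InfCongruent.parameters_eq (hm : RingHom.ker ε ^ 2 = ⊥) {t₁ t₂ s₁ s₂ : B}
    (ht₁ : ε t₁ = 0) (ht₂ : ε t₂ = 0) (hs₁ : ε s₁ = 0) (hs₂ : ε s₂ = 0)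
    (h : InfCongruent ε (infMatrix t₁ t₂) (infMatrix s₁ s₂)) : t₁ = s₁ ∧ t₂ = s₂ := by
  obtain ⟨g, hg, h⟩ := h
  have hmul {x y : B} (hx : ε x = 0) (hy : ε y = 0) : x * y = 0 := by
    rw [← Ideal.mem_bot, ← hm, pow_two]
    exact Ideal.mul_mem_mul hx hy
  have hgε : g.val.map ε = 1 := congrArg Units.val hg
  have e (i j) : ε (g.val i j) = (1 : Matrix (Fin 3) (Fin 3) ℂ) i j := congr_fun₂ hgε i j
  have hdet : ε (g.val.det - 1) = 0 := by
    have := AlgHom.map_det ε g.val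
    rw [AlgHom.mapMatrix_apply, hgε, Matrix.det_one] at this
    rw [map_sub, this, map_one, sub_self]
  have h01 := congr_fun₂ h 0 1
  have h10 := congr_fun₂ h 1 0
  have h22 := congr_fun₂ h 2 2
  rw [mul_mul_transpose_apply] at h01 h10 h22
  generalize g.val = g at *
  simp [infMatrix] at h01 h10 h22
  have a₁ : (g.det - 1) * t₁ = 0 := hmul hdet ht₁
  have a₂ : (g.det - 1) * t₂ = 0 := hmul hdet ht₂
  have a₃ : (g 0 0 * g 1 1 - g 0 1 * g 1 0 - 1) * s₁ = 0 := hmul (by simp [e]) hs₁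
  have a₄ : (g 2 2 ^ 2 - 1) * s₂ = 0 := hmul (by simp [e]) hs₂
  have a₅ : g 2 0 * (g 2 0 - (1 + s₁) * g 2 1 - g 2 1) = 0 := hmul (by simp [e]) (by simp [e])
  constructor
  · linear_combination h10 - h01 - a₁ + a₃
  · linear_combination h22 - a₂ + a₄ + a₅

theorem isMiniversal_dInf :
    IsMiniversal.{u} (dFam ℂ 1 (-1)) Base Base.aug (dInf Base (Base.t 0) (Base.t 1)) := by
  have hd : dFam ℂ 1 (-1) = ofMatrix (infMatrix 0 0) := by rw [dFam_eq, sub_self]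
  refine ⟨⟨⟨Base.isFormalAlgebra, (isCodifferential_dInf_iff _ _).mpr Base.t_mul_t, ?_⟩, ?_⟩, ?_⟩
  · rw [push_dInf, RingHom.coe_coe, Base.aug_t, Base.aug_t, dInf_eq, hd]
  · intro B _ _ ε dB h
    have hM : IsCodifferential (ofMatrix (toMatrix dB)) := by
      rw [ofMatrix_toMatrix]
      exact h.isCodifferential
    have hε : (toMatrix dB).map ε = infMatrix 0 0 := by
      have := h.push_eq
      rw [← ofMatrix_toMatrix dB, push_ofMatrix, hd] at this
      exact ofMatrix_injective this
    obtain ⟨t₁, t₂, ht₁, ht₂, hc⟩ := exists_infCongruent_infMatrix h.isFormalAlgebra hM hε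
    have hmul : t₁ * t₂ = 0 := by
      rw [← isCodifferential_dInf_iff, dInf_eq]
      exact hc.symm.isCodifferential hM
    obtain ⟨f, hf₁, hf₂⟩ := h.isFormalAlgebra.exists_algHom_base ht₁ ht₂ hmul
    refine ⟨f, ?_⟩
    rw [push_dInf, RingHom.coe_coe, hf₁, hf₂, dInf_eq, ← ofMatrix_toMatrix dB,
      infEquivalent_ofMatrix_iff]
    exact hc
  · intro B _ _ ε dB h hm f f' hf hf'
    rw [push_dInf, dInf_eq, ← ofMatrix_toMatrix dB, infEquivalent_ofMatrix_iff] at hf hf'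
    have hε (f : Base →ₐ[ℂ] B) (i : Fin 2) : ε (f (Base.t i)) = 0 :=
      (DFunLike.congr_fun (Base.isFormalAlgebra.algHom_eq (ε.comp f)) (Base.t i)).trans
        (Base.aug_t i)
    obtain ⟨h₁, h₂⟩ := (hf.trans hf'.symm).parameters_eq hm (hε f 0) (hε f 1) (hε f' 0) (hε f' 1)
    exact IsFormalAlgebra.base_algHom_ext hm (Fin.forall_fin_two.mpr ⟨h₁, h₂⟩)

end Versality

/-! ### Equivalence of the structures over a field -/

section Equivalence

theorem exists_pullback_dInf_eq_dThree {K : Type*} [Field K] (h2 : (2 : K) ≠ 0) {t : K}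
    (ht : t ≠ 0) :
    ∃ g : GL (Fin 3) K,
      (g : Matrix (Fin 3) (Fin 3) K) =
        !![0, -(1 / 2) * ((t - 1) / t), -(1 / 2) * ((1 + t) / t); 0, 1, 1; 1, 0, 0] ∧
      pullback g (dInf K 0 t) = dThree K := by
  have hdet : (!![0, -(1 / 2) * ((t - 1) / t), -(1 / 2) * ((1 + t) / t); 0, 1, 1; 1, 0, 0] :
      Matrix (Fin 3) (Fin 3) K).det = t⁻¹ := by
    simp [Matrix.det_fin_three]
    field_simp
    ring
  refine ⟨Matrix.GeneralLinearGroup.mkOfDetNeZero _ (by rw [hdet]; exact inv_ne_zero ht), rfl, ?_⟩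
  rw [dInf_eq, dThree_eq, pullback_ofMatrix_eq_iff]
  change Matrix.det !![0, -(1 / 2) * ((t - 1) / t), -(1 / 2) * ((1 + t) / t); 0, 1, 1; 1, 0, 0] • _ =
    !![0, -(1 / 2) * ((t - 1) / t), -(1 / 2) * ((1 + t) / t); 0, 1, 1; 1, 0, 0] * _ *
      !![0, -(1 / 2) * ((t - 1) / t), -(1 / 2) * ((1 + t) / t); 0, 1, 1; 1, 0, 0]ᵀ
  rw [hdet]
  ext i j
  rw [mul_mul_transpose_apply]
  fin_cases i <;> fin_cases j <;> simp [infMatrix] <;> field_simp <;> ring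

/-- The rank of the structure matrix distinguishes `d(1 : -1)` from `d_3`. -/
theorem not_equivalent_dFam_dThree : ¬ Equivalent (dFam ℂ 1 (-1)) (dThree ℂ) := by
  rintro ⟨g, hg⟩
  rw [dFam_eq, dThree_eq, pullback_ofMatrix_eq_iff] at hg
  have hu : g.val.det ≠ 0 := ((Matrix.isUnit_iff_isUnit_det _).mp g.isUnit).ne_zero
  have := congrArg Matrix.det hg
  have h0 : (infMatrix ((1 : ℂ) - 1) 0).det = 0 := by simp [infMatrix, Matrix.det_fin_three]
  have h1 : (!![1, 0, 0; 0, -1, 0; 0, 0, 1] : Matrix (Fin 3) (Fin 3) ℂ).det = -1 := by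
    simp [Matrix.det_fin_three]
  rw [Matrix.det_smul, Matrix.det_mul, Matrix.det_mul, Matrix.det_transpose, h0, h1, mul_zero]
    at this
  exact mul_ne_zero (mul_ne_zero hu (neg_ne_zero.mpr one_ne_zero)) hu this.symm

theorem isFormalJump_dInf :
    IsFormalJump (dFam ℂ 1 (-1)) (dThree ℂ) (dInf ℂ⟦X⟧ 0 PowerSeries.X) := by
  refine ⟨⟨powerSeries_isFormalAlgebra, ?_, ?_⟩, ?_, not_equivalent_dFam_dThree⟩
  · rw [isCodifferential_dInf_iff, zero_mul]
  · have : powerSeriesAug PowerSeries.X = 0 := PowerSeries.constantCoeff_X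
    rw [push_dInf, RingHom.coe_coe, map_zero, this, dInf_eq, dFam_eq, sub_self]
  · rw [push_dInf, push_dThree, map_zero]
    have hX : algebraMap ℂ⟦X⟧ ℂ⸨X⸩ PowerSeries.X ≠ 0 :=
      (map_ne_zero_iff _ (IsFractionRing.injective ℂ⟦X⟧ ℂ⸨X⸩)).mpr PowerSeries.X_ne_zero
    have h2 : (2 : ℂ⸨X⸩) ≠ 0 := by
      rw [← map_ofNat (algebraMap ℂ ℂ⸨X⸩) 2]
      exact (map_ne_zero _).mpr two_ne_zero
    obtain ⟨g, -, hg⟩ := exists_pullback_dInf_eq_dThree h2 hX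
    exact ⟨g, hg⟩

theorem exists_linearEquiv_dThree_sl :
    ∃ e : (Fin 3 → ℂ) ≃ₗ[ℂ] LieAlgebra.SpecialLinear.sl (Fin 2) ℂ,
      ∀ x y : Fin 3 → ℂ, e (dThree ℂ ![x, y]) = ⁅e x, e y⁆ := by
  let F : (Fin 3 → ℂ) → Matrix (Fin 2) (Fin 2) ℂ := fun x =>
    !![x 0 / 2, (x 1 + x 2) / 2; (x 2 - x 1) / 2, -(x 0 / 2)]
  have hF (x) : F x ∈ LieAlgebra.SpecialLinear.sl (Fin 2) ℂ := by
    simp [LieAlgebra.SpecialLinear.sl, LinearMap.mem_ker, F, Matrix.trace_fin_two]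
  refine ⟨{ toFun := fun x => ⟨F x, hF x⟩
            invFun := fun A => ![2 * A.1 0 0, A.1 0 1 - A.1 1 0, A.1 0 1 + A.1 1 0]
            map_add' := fun x y => ?_
            map_smul' := fun c x => ?_
            left_inv := fun x => ?_
            right_inv := fun A => ?_ }, fun x y => ?_⟩
  · refine Subtype.ext ?_
    ext i j
    fin_cases i <;> fin_cases j <;> simp [F] <;> ring
  · refine Subtype.ext ?_
    ext i j
    fin_cases i <;> fin_cases j <;> simp [F] <;> ring
  · ext i
    fin_cases i <;> simp [F] <;> ring
  · have hA : A.1 0 0 + A.1 1 1 = 0 := by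
      rw [← Matrix.trace_fin_two]
      exact A.2
    refine Subtype.ext ?_
    ext i j
    fin_cases i <;> fin_cases j <;> simp [F]
    linear_combination -hA
  · refine Subtype.ext ?_
    change F (dThree ℂ ![x, y]) = ⁅F x, F y⁆
    rw [dThree_eq, ofMatrix_apply, Ring.lie_def]
    ext i j
    fin_cases i <;> fin_cases j <;> simp [F, cross_apply] <;> ring

/-- An equivalence rescales the upper left block of the structure matrix by a congruence, so the
ratio of the determinants of its symmetric and skew parts, `(1 + l)² : (1 - l)²` up to sign, is an
invariant. -/
theorem equivalent_dFam_iff (l m : ℂ) :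
    Equivalent (dFam ℂ l (-1)) (dFam ℂ m (-1)) ↔ l = m ∨ l * m = 1 := by
  rw [dFam_eq, dFam_eq]
  constructor
  · rintro ⟨g, hg⟩
    rw [pullback_ofMatrix_eq_iff] at hg
    have hu : g.val.det ≠ 0 := ((Matrix.isUnit_iff_isUnit_det _).mp g.isUnit).ne_zero
    have e (i j) := congr_fun₂ hg i j
    simp only [mul_mul_transpose_apply] at e
    generalize g.val = g at *
    have hker {x y : ℂ} (h : ∀ i, x * g i 0 + y * g i 1 = 0) : x = 0 ∧ y = 0 := by
      have : ![x, y, 0] = 0 := by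
        refine Matrix.eq_zero_of_mulVec_eq_zero hu ?_
        ext i
        simp only [Matrix.mulVec, dotProduct, Fin.sum_univ_three, Matrix.cons_val, Pi.zero_apply]
        linear_combination h i
      exact ⟨congr_fun this 0, congr_fun this 1⟩
    -- The third row of `g` lies in both radicals of the form, which meet in a line.
    obtain ⟨-, h₁⟩ := hker (x := g 2 0 - m * g 2 1) (y := -g 2 0) fun i => by
      have := e i 2
      fin_cases i <;> simp [infMatrix] at this ⊢ <;> linear_combination -this
    rw [neg_eq_zero] at h₁
    obtain ⟨h₂, -⟩ := hker (x := g 2 0 - g 2 1) (y := -m * g 2 0) fun i => by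
      have := e 2 i
      fin_cases i <;> simp [infMatrix] at this ⊢ <;> linear_combination -this
    rw [h₁, zero_sub, neg_eq_zero] at h₂
    have h00 := e 0 0
    have h01 := e 0 1
    have h10 := e 1 0
    have h11 := e 1 1
    simp [infMatrix] at h00 h01 h10 h11
    generalize g.det = δ at *
    have hskew : δ * (1 - l) = (g 0 0 * g 1 1 - g 0 1 * g 1 0) * (1 - m) := by
      linear_combination h01 - h10
    have hsum : δ * (1 + l) = -((g 0 0 - g 0 1) * g 1 0 - g 0 0 * m * g 1 1 +
        ((g 1 0 - g 1 1) * g 0 0 - g 1 0 * m * g 0 1)) := by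
      linear_combination -h01 - h10
    have hsym : δ ^ 2 * (1 + l) ^ 2 = (g 0 0 * g 1 1 - g 0 1 * g 1 0) ^ 2 * (1 + m) ^ 2 := by
      linear_combination (δ * (1 + l) - ((g 0 0 - g 0 1) * g 1 0 - g 0 0 * m * g 1 1 +
        ((g 1 0 - g 1 1) * g 0 0 - g 1 0 * m * g 0 1))) * hsum -
        4 * ((g 0 0 - g 0 1) * g 0 0 - g 0 0 * m * g 0 1) * h11
    have hprod : δ ^ 2 * (4 * ((l - m) * (1 - l * m))) = 0 := by
      linear_combination (1 - m) ^ 2 * hsym - (1 + m) ^ 2 *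
        (δ * (1 - l) + (g 0 0 * g 1 1 - g 0 1 * g 1 0) * (1 - m)) * hskew
    have h4 : (l - m) * (1 - l * m) = 0 := by
      simpa [hu] using hprod
    rcases mul_eq_zero.mp h4 with h | h
    · exact Or.inl (sub_eq_zero.mp h)
    · exact Or.inr (sub_eq_zero.mp h).symm
  · rintro (rfl | h)
    · exact ⟨1, by rw [pullback_ofMatrix_eq_iff]; simp⟩
    · have hm : m ≠ 0 := right_ne_zero_of_mul_eq_one h
      let g : Matrix (Fin 3) (Fin 3) ℂ := !![-m, 0, 0; 1 + m, 1, 0; 0, 0, -m]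
      have hdet : g.det = m ^ 2 := by
        simp [g, Matrix.det_fin_three]
        ring
      refine ⟨Matrix.GeneralLinearGroup.mkOfDetNeZero g (by rw [hdet]; exact pow_ne_zero 2 hm), ?_⟩
      rw [pullback_ofMatrix_eq_iff]
      change g.det • _ = g * _ * gᵀ
      rw [hdet]
      ext i j
      rw [mul_mul_transpose_apply]
      fin_cases i <;> fin_cases j <;> simp [g, infMatrix]
      · ring
      · linear_combination (-m) * h
      · ring
      · ring

end Equivalence

end LieDeform

end

theorem mainTheorem4 :
    -- the bracket over `ℂ[[t₁, t₂]]`: `[d, d] = -2 φ^{123}_3 t₁ t₂`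
    (∀ v : Fin 3 → Fin 3 → MvPowerSeries (Fin 2) ℂ,
      LieDeform.selfBracket
          (LieDeform.dInf (MvPowerSeries (Fin 2) ℂ) (MvPowerSeries.X 0) (MvPowerSeries.X 1)) v =
        (-2 * (MvPowerSeries.X 0 * MvPowerSeries.X 1) : MvPowerSeries (Fin 2) ℂ) •
          LieDeform.phi (MvPowerSeries (Fin 2) ℂ) ![0, 1, 2] 2 v) ∧
    -- the miniversal deformation, with base `ℂ[[t₁, t₂]] / (t₁ t₂)`
    LieDeform.IsMiniversal.{u} (LieDeform.dFam ℂ 1 (-1)) LieDeform.Base LieDeform.Base.aug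
      (LieDeform.dInf LieDeform.Base (LieDeform.Base.t 0) (LieDeform.Base.t 1)) ∧
    -- complex parameter values give a Lie algebra only on the two curves
    (∀ t₁ t₂ : ℂ,
      LieDeform.IsCodifferential (LieDeform.dInf ℂ t₁ t₂) ↔ t₁ = 0 ∨ t₂ = 0) ∧
    -- along `t₁ = 0`: a jump deformation to `d_3`, which is `sl_2(ℂ)`
    (∃ c : LieDeform.Base →ₐ[ℂ] PowerSeries ℂ,
      c (LieDeform.Base.t 0) = 0 ∧ c (LieDeform.Base.t 1) = PowerSeries.X ∧
      LieDeform.IsFormalJump (LieDeform.dFam ℂ 1 (-1)) (LieDeform.dThree ℂ)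
        (LieDeform.push (c : LieDeform.Base →+* PowerSeries ℂ)
          (LieDeform.dInf LieDeform.Base (LieDeform.Base.t 0) (LieDeform.Base.t 1)))) ∧
    (∀ t : ℂ, t ≠ 0 → ∃ g : GL (Fin 3) ℂ,
      (g : Matrix (Fin 3) (Fin 3) ℂ) =
        !![0, -(1 / 2) * ((t - 1) / t), -(1 / 2) * ((1 + t) / t); 0, 1, 1; 1, 0, 0] ∧
      LieDeform.pullback g (LieDeform.dInf ℂ 0 t) = LieDeform.dThree ℂ) ∧
    (∃ e : (Fin 3 → ℂ) ≃ₗ[ℂ] LieAlgebra.SpecialLinear.sl (Fin 2) ℂ,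
      ∀ x y : Fin 3 → ℂ, e (LieDeform.dThree ℂ ![x, y]) = ⁅e x, e y⁆) ∧
    -- along `t₂ = 0`: the deformation moves along the family `d(λ:μ)`
    (∃ c : LieDeform.Base →ₐ[ℂ] PowerSeries ℂ,
      c (LieDeform.Base.t 0) = PowerSeries.X ∧ c (LieDeform.Base.t 1) = 0 ∧
      LieDeform.push (c : LieDeform.Base →+* PowerSeries ℂ)
          (LieDeform.dInf LieDeform.Base (LieDeform.Base.t 0) (LieDeform.Base.t 1)) =
        LieDeform.dFam (PowerSeries ℂ) (1 + PowerSeries.X) (-1)) ∧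
    (∀ t : ℂ, LieDeform.dInf ℂ t 0 = LieDeform.dFam ℂ (1 + t) (-1)) ∧
    (∀ s t : ℂ,
      LieDeform.Equivalent (LieDeform.dFam ℂ (1 + s) (-1)) (LieDeform.dFam ℂ (1 + t) (-1)) ↔
        s = t ∨ (1 + s) * (1 + t) = 1) := by
  refine ⟨fun v => ?_, LieDeform.isMiniversal_dInf, fun t₁ t₂ => ?_, ?_, fun t ht => ?_,
    LieDeform.exists_linearEquiv_dThree_sl, ?_, fun t => ?_, fun s t => ?_⟩
  · have hv : v = ![v 0, v 1, v 2] := by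
      ext i; fin_cases i <;> rfl
    rw [LieDeform.selfBracket, LieDeform.dInf_jacobiator, ← hv, ← Nat.cast_smul_eq_nsmul
      (MvPowerSeries (Fin 2) ℂ), smul_smul]
    congr 1
    push_cast
    ring
  · rw [LieDeform.isCodifferential_dInf_iff, mul_eq_zero]
  · obtain ⟨c, h₁, h₂⟩ := LieDeform.powerSeries_isFormalAlgebra.exists_algHom_base
      (b₁ := 0) (b₂ := PowerSeries.X) (map_zero _) PowerSeries.constantCoeff_X (zero_mul _)
    refine ⟨c, h₁, h₂, ?_⟩
    rw [LieDeform.push_dInf, RingHom.coe_coe, h₁, h₂]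
    exact LieDeform.isFormalJump_dInf
  · exact LieDeform.exists_pullback_dInf_eq_dThree two_ne_zero ht
  · obtain ⟨c, h₁, h₂⟩ := LieDeform.powerSeries_isFormalAlgebra.exists_algHom_base
      (b₁ := PowerSeries.X) (b₂ := 0) PowerSeries.constantCoeff_X (map_zero _) (mul_zero _)
    refine ⟨c, h₁, h₂, ?_⟩
    rw [LieDeform.push_dInf, RingHom.coe_coe, h₁, h₂, LieDeform.dInf_eq, LieDeform.dFam_eq,
      add_sub_cancel_left]
  · rw [LieDeform.dInf_eq, LieDeform.dFam_eq, add_sub_cancel_left]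
  · rw [LieDeform.equivalent_dFam_iff, add_right_inj]
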